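/- **Setting.** A linear relation in a complex Hilbert space $H$ is a linear subspace of $H\times H$; for such a relation $A$ and $x\in\mathbb R$ put $\ker(A-x):=\{f\in H:\ (f;xf)\in A\}$, let $\sigma_p(A)$ be the set of $x$ with $\ker(A-x)\neq\{0\}$, and call $\dim\ker(A-x)$ the multiplicity of the eigenvalue $x$. A closed symmetric relation $S$ is called simple if there is no orthogonal decomposition $H=K\oplus K^\perp$, $S=(S\cap K^2)\oplus(S\cap (K^\perp)^2)$ with $K\neq\{0\}$ and $S\cap K^2$ selfadjoint in $K$. A boundary relation for $S^*$ with boundary space $B$ is a linear subspace $\Gamma\subseteq H^2\times B^2$ whose domain $\{(f;g):\ \exists\,(\alpha;\beta),\ ((f;g);(\alpha;\beta))\in\Gamma\}$ is a dense subset of $S^*$, whose elements satisfy pairwise Green's identity $$(g,f')_H-(f,g')_H=(\beta,\alpha')_B-(\alpha,\beta')_B ,$$ and which is maximal in the sense that every element of $H^2\times B^2$ satisfying this identity with all elements of $\Gamma$ belongs to $\Gamma$. Put $\operatorname{mul}\Gamma:=\{(\alpha;\beta):\ ((0;0);(\alpha;\beta))\in\Gamma\}$. The relation $\Gamma$ is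 of function type if $\operatorname{mul}\Gamma\cap(\{0\}\times B)=\{0\}$, and is a boundary function if $\operatorname{mul}\Gamma=\{0\}$. Write $\ker[\pi_1\circ\Gamma]:=\{(f;g):\ \exists\,\beta,\ ((f;g);(0;\beta))\in\Gamma\}$. If $B=\mathbb C$ and $\Gamma$ is of function type, its Weyl function $m$ assigns to $z\in\mathbb C\setminus\mathbb R$ the unique number $m(z)$ such that $((f;zf);(1;m(z)))\in\Gamma$ for some $f\in H$. **Theorem.** Let $n\ge 2$, and for each $l\in\{1,\dots,n\}$ let $S_l$ be a closed symmetric simple linear relation in a Hilbert space $H_l$ and $\Gamma_l\subseteq H_l^2\times\mathbb C^2$ a boundary relation for $S_l^*$ of function type with Weyl function $m_l$. Assume that at least one $\Gamma_l$ is a boundary function. Put $A_l:=\ker[\pi_1\circ\Gamma_l]$, and let $A:=\ker[\pi_1\circ\Gamma]$ be the pasting of $\Gamma_1,\dots,\Gamma_n$ with standard interface conditions, where $\Gamma\subseteq\big(\prod_l H_l\big)^2\times(\mathbb C^n)^2$ consists of all elements $$\Big(\big((f_l)_l;(g_l)_l\big);\big((-\alpha_1+\alpha_n,\dots,-\alpha_{n-1}+\alpha_n,\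 \beta_1+\dots+\beta_n);(-\beta_1,\dots,-\beta_{n-1},-\alpha_n)\big)\Big)$$ with $((f_l;g_l);(\alpha_l;\beta_l))\in\Gamma_l$ for $l=1,\dots,n$. Let $x\in\mathbb R$. Then $x\in\sigma_p(A)$ if and only if one of the following two alternatives takes place. (I/II) The point $x$ belongs to at least two of the point spectra $\sigma_p(A_l)$. In this case the multiplicity of the eigenvalue $x$ of $A$ is $$\#\{l:\ x\in\sigma_p(A_l)\}-1=\#\Big\{l:\ \lim_{\varepsilon\downarrow0}\varepsilon\,\operatorname{Im}m_l(x+i\varepsilon)>0\Big\}-1 .$$ (III) For all $l$ the limit $m_l(x):=\lim_{\varepsilon\downarrow0}m_l(x+i\varepsilon)$ exists and is real, the limit $\lim_{\varepsilon\downarrow0}\frac1{i\varepsilon}\big(m_l(x+i\varepsilon)-m_l(x)\big)$ exists and lies in $[0,\infty)$, and $\sum_{l=1}^n m_l(x)=0$. In this case $x$ is a simple eigenvalue of $A$, i.e. its multiplicity is $1$. -/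

import Mathlib

open Filter Topology

/-! Linear relations in `E` are submodules of `E × E`; a pair `(f; g)` is `(f, g)`. The adjoint of a
linear relation is Mathlib's `Submodule.adjoint`. -/

noncomputable section

namespace Pasting

section Relations

variable {E : Type*} [NormedAddCommGroup E] [InnerProductSpace ℂ E]

/-- A linear relation is symmetric if it is contained in its adjoint. -/
def IsSymmetricRel (S : Submodule ℂ (E × E)) : Prop :=
  S ≤ S.adjoint

/-- A linear relation is selfadjoint if it equals its adjoint. -/
def IsSelfAdjointRel (S : Submodule ℂ (E × E)) : Prop :=
  S.adjoint = S

/-- The part `S ∩ K²` of a linear relation in a subspace `K`, as a relation in `E`. -/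
def part (S : Submodule ℂ (E × E)) (K : Submodule ℂ E) : Submodule ℂ (E × E) :=
  S ⊓ K.prod K

/-- The part `S ∩ K²` of a linear relation in a subspace `K`, as a relation in `K`. -/
def partIn (S : Submodule ℂ (E × E)) (K : Submodule ℂ E) : Submodule ℂ (K × K) :=
  S.comap (K.subtype.prodMap K.subtype)

/-- A linear relation is simple (completely non-selfadjoint) if there is no orthogonal decomposition
`E = K ⊕ Kᗮ`, `S = (S ∩ K²) ⊕ (S ∩ (Kᗮ)²)` with `K ≠ {0}` such that the part of `S` in `K` is
selfadjoint. -/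
def IsSimpleRel (S : Submodule ℂ (E × E)) : Prop :=
  ∀ K : Submodule ℂ E, IsClosed (K : Set E) →
    S = part S K ⊔ part S Kᗮ → IsSelfAdjointRel (partIn S K) → K = ⊥

/-- `ker (A - x)` for a linear relation `A`: all `f` with `(f; x f) ∈ A`. -/
def eigenspace (A : Submodule ℂ (E × E)) (x : ℂ) : Submodule ℂ E :=
  A.comap (LinearMap.prod LinearMap.id (x • LinearMap.id))

/-- The point spectrum of a linear relation. -/
def pointSpectrum (A : Submodule ℂ (E × E)) : Set ℂ :=
  {x | eigenspace A x ≠ ⊥}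

/-- The multiplicity of a point as an eigenvalue, the dimension of `ker (A - x)`. -/
def eigenMultiplicity (A : Submodule ℂ (E × E)) (x : ℂ) : Cardinal :=
  Module.rank ℂ (eigenspace A x)

theorem mem_eigenspace (A : Submodule ℂ (E × E)) (x : ℂ) (f : E) :
    f ∈ eigenspace A x ↔ (f, x • f) ∈ A :=
  Iff.rfl

end Relations

section BoundaryRelations

variable {E : Type*} [NormedAddCommGroup E] [InnerProductSpace ℂ E]
variable {B : Type*} [NormedAddCommGroup B] [InnerProductSpace ℂ B]

/-- Two elements `((f; g); (α; β))` and `((f'; g'); (α'; β'))` satisfy the abstract Green's identity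
`(g, f') - (f, g') = (β, α') - (α, β')`, where `(·, ·)` is linear in the first argument
(Mathlib's `inner` is linear in the second one). -/
def Green (p q : (E × E) × (B × B)) : Prop :=
  inner ℂ q.1.1 p.1.2 - inner ℂ q.1.2 p.1.1 = inner ℂ q.2.1 p.2.2 - inner ℂ q.2.2 p.2.1

/-- `Γ ⊆ E² × B²` is a boundary relation for `S*`. -/
structure IsBoundaryRelation (S : Submodule ℂ (E × E)) (Γ : Submodule ℂ ((E × E) × (B × B))) :
    Prop where
  /-- The domain of `Γ` is contained in `S*`. -/
  dom_le : ∀ p ∈ Γ, p.1 ∈ S.adjoint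
  /-- The domain of `Γ` is dense in `S*`. -/
  dom_dense : (S.adjoint : Set (E × E)) ⊆ closure (Prod.fst '' (Γ : Set ((E × E) × (B × B))))
  /-- Green's identity. -/
  green : ∀ p ∈ Γ, ∀ q ∈ Γ, Green p q
  /-- Maximality: an element satisfying Green's identity with all elements of `Γ` is in `Γ`. -/
  maximal : ∀ q, (∀ p ∈ Γ, Green p q) → q ∈ Γ

/-- `Γ` is of function type: `mul Γ ∩ ({0} × B) = {0}`. -/
def IsFunctionType (Γ : Submodule ℂ ((E × E) × (B × B))) : Prop :=
  ∀ β : B, ((0, 0), (0, β)) ∈ Γ → β = 0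

/-- `Γ` is a boundary function: `mul Γ = {0}`. -/
def IsBoundaryFunction (Γ : Submodule ℂ ((E × E) × (B × B))) : Prop :=
  ∀ α β : B, ((0, 0), (α, β)) ∈ Γ → α = 0 ∧ β = 0

/-- The relation `ker (π₁ ∘ Γ)`: all `(f; g)` with `((f; g); (0; β)) ∈ Γ` for some `β`. -/
def kerPi₁ (Γ : Submodule ℂ ((E × E) × (B × B))) : Submodule ℂ (E × E) where
  carrier := {p | ∃ β : B, (p, (0, β)) ∈ Γ}
  zero_mem' := ⟨0, Γ.zero_mem⟩
  add_mem' := by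
    rintro p q ⟨β, hp⟩ ⟨γ, hq⟩
    exact ⟨β + γ, by simpa using Γ.add_mem hp hq⟩
  smul_mem' := by
    rintro c p ⟨β, hp⟩
    exact ⟨c • β, by simpa using Γ.smul_mem c hp⟩

/-- The Weyl family: `M(z)` consists of all `(α; β)` with `((f; z f); (α; β)) ∈ Γ` for some `f`. -/
def weylFamily (Γ : Submodule ℂ ((E × E) × (B × B))) (z : ℂ) : Set (B × B) :=
  {b | ∃ f : E, ((f, z • f), b) ∈ Γ}

/-- The Weyl function for `B = ℂ`: the number `m(z)` with `(1; m(z)) ∈ M(z)`. For a boundary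
relation of function type and nonreal `z`, the relation `M(z)` is the graph of multiplication by
`m(z)`. -/
def weylFunction (Γ : Submodule ℂ ((E × E) × (ℂ × ℂ))) (z : ℂ) : ℂ :=
  Classical.epsilon fun β : ℂ => ((1 : ℂ), β) ∈ weylFamily Γ z

end BoundaryRelations

section Paste

variable {n : ℕ} {H : Fin n → Type*} [∀ l, NormedAddCommGroup (H l)]
  [∀ l, InnerProductSpace ℂ (H l)]

/-- The largest index. -/
def lastIdx (hn : 2 ≤ n) : Fin n :=
  ⟨n - 1, by omega⟩

/-- The first boundary component `(-α₁ + αₙ, …, -αₙ₋₁ + αₙ, β₁ + ⋯ + βₙ)`. -/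
def pasteFst (hn : 2 ≤ n) (α β : Fin n → ℂ) : EuclideanSpace ℂ (Fin n) :=
  WithLp.toLp 2 fun l => if l = lastIdx hn then ∑ k, β k else -α l + α (lastIdx hn)

/-- The second boundary component `(-β₁, …, -βₙ₋₁, -αₙ)`. -/
def pasteSnd (hn : 2 ≤ n) (α β : Fin n → ℂ) : EuclideanSpace ℂ (Fin n) :=
  WithLp.toLp 2 fun l => if l = lastIdx hn then -α l else -β l

/-- The boundary relation in `(∏ H_l)² × (ℂⁿ)²` obtained from `Γ₁, …, Γₙ` with standard interface
conditions; `PiLp 2 H` is the Hilbert space product. -/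
def pasteRel (hn : 2 ≤ n) (Γ : ∀ l, Submodule ℂ ((H l × H l) × (ℂ × ℂ))) :
    Submodule ℂ ((PiLp 2 H × PiLp 2 H) ×
      (EuclideanSpace ℂ (Fin n) × EuclideanSpace ℂ (Fin n))) where
  carrier := {p | ∃ α β : Fin n → ℂ, (∀ l, ((p.1.1 l, p.1.2 l), (α l, β l)) ∈ Γ l) ∧
    p.2 = (pasteFst hn α β, pasteSnd hn α β)}
  zero_mem' := by
    refine ⟨0, 0, fun l => (Γ l).zero_mem, ?_⟩
    ext l <;> simp [pasteFst, pasteSnd]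
  add_mem' := by
    rintro p q ⟨α, β, hp, hp'⟩ ⟨α', β', hq, hq'⟩
    refine ⟨α + α', β + β', fun l => by simpa using (Γ l).add_mem (hp l) (hq l), ?_⟩
    rw [Prod.snd_add, hp', hq']
    ext l
    · by_cases h : l = lastIdx hn
      · simp [pasteFst, h, Finset.sum_add_distrib]
      · simp [pasteFst, h]; ring
    · by_cases h : l = lastIdx hn
      · simp [pasteSnd, h]; ring
      · simp [pasteSnd, h]; ring
  smul_mem' := by
    rintro c p ⟨α, β, hp, hp'⟩
    refine ⟨c • α, c • β, fun l => by simpa using (Γ l).smul_mem c (hp l), ?_⟩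
    rw [Prod.smul_snd, hp']
    ext l
    · by_cases h : l = lastIdx hn
      · simp [pasteFst, h, Finset.mul_sum]
      · simp [pasteFst, h]; ring
    · by_cases h : l = lastIdx hn <;> simp [pasteSnd, h]

/-- The relation constructed by pasting `Γ₁, …, Γₙ` with standard interface conditions. -/
def pasting (hn : 2 ≤ n) (Γ : ∀ l, Submodule ℂ ((H l × H l) × (ℂ × ℂ))) :
    Submodule ℂ (PiLp 2 H × PiLp 2 H) :=
  kerPi₁ (pasteRel hn Γ)

/-- At least two of the relations `A_l = ker (π₁ ∘ Γ_l)` have the eigenvalue `x`. -/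
def AlternativeOverlap (Γ : ∀ l, Submodule ℂ ((H l × H l) × (ℂ × ℂ))) (x : ℝ) : Prop :=
  2 ≤ {l : Fin n | (x : ℂ) ∈ pointSpectrum (kerPi₁ (Γ l))}.ncard

/-- The normal limits `m_l(x)` of the Weyl functions all exist and are real (`m l = m_l(x)`), the
normal derivatives `lim (m_l(x + iε) - m_l(x)) / (iε)` exist in `[0, ∞)`, and `∑ m_l(x) = 0`. -/
def AlternativeNew (Γ : ∀ l, Submodule ℂ ((H l × H l) × (ℂ × ℂ))) (x : ℝ) : Prop :=
  ∃ m : Fin n → ℝ,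
    (∀ l, Tendsto (fun ε : ℝ => weylFunction (Γ l) (x + Complex.I * ε)) (𝓝[>] 0) (𝓝 (m l : ℂ))) ∧
    (∀ l, ∃ d : ℝ, 0 ≤ d ∧
      Tendsto (fun ε : ℝ => 1 / (Complex.I * ε) *
        (weylFunction (Γ l) (x + Complex.I * ε) - m l)) (𝓝[>] 0) (𝓝 (d : ℂ))) ∧
    ∑ l, m l = 0

end Paste

end Pasting

end

/-! A unitary relation `Γ` between the Krein spaces `H²` and `B²` is, up to a change of signs, the
same thing as a selfadjoint relation in `H × B`. Surjectivity of the shifted selfadjoint relation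
yields the Weyl function `m` and the `γ`-field `γ(z)`, with `((γ(z); z γ(z)); (1; m(z))) ∈ Γ`. Write
`γ_ε` for `γ(x + iε)`. Green's identity between two points of a vertical ray gives
`(ε + δ) ‖γ_ε - γ_δ‖² = (δ - ε) (‖γ_ε‖² - ‖γ_δ‖²)` and a similar identity for `ε γ_ε`. Hence
`‖γ_ε‖` decreases and `ε ‖γ_ε‖` increases in `ε`, and convergence of these norms forces convergence
of the vectors; as `Γ` is closed, the limits are solutions at `x`. In this way `ε Im m(x + iε) =
‖ε γ_ε‖²` has a positive limit exactly at the eigenvalues of `ker (π₁ ∘ Γ)`, and `(1; β)` is the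
boundary value of a solution at `x` exactly if `m` has the normal limit `β` and a finite normal
derivative, which is the limit of `‖γ_ε‖²`.

An eigenvector of the pasting at `x` consists of solutions `(f_l, α, β_l)` at `x` with a common `α`
and `∑ β_l = 0`. If some `Γ_l` has a solution `(e, 0, 1)`, pairing with it forces `α = 0`; the
`(f_l, β_l)` then run through a sum of lines, one for each `l` with `x ∈ σ_p(A_l)`, subject to one
linear condition. Otherwise each `f_l` is determined by `α`, which leaves at most one dimension. -/

namespace Pasting

open Complex ComplexConjugate InnerProductSpace

section Adjoint

variable {𝕜 E F : Type*} [RCLike 𝕜] [NormedAddCommGroup E] [InnerProductSpace 𝕜 E]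
  [NormedAddCommGroup F] [InnerProductSpace 𝕜 F]

theorem adjoint_adjoint_of_isClosed [CompleteSpace E] [CompleteSpace F] {S : Submodule 𝕜 (E × F)}
    (hS : IsClosed (S : Set (E × F))) : S.adjoint.adjoint = S := by
  let T : Submodule 𝕜 (WithLp 2 (E × F)) := S.comap (WithLp.linearEquiv 2 𝕜 (E × F)).toLinearMap
  have : CompleteSpace T :=
    (hS.preimage (WithLp.prod_continuous_ofLp 2 E F)).completeSpace_coe
  refine le_antisymm (fun p hp => ?_) fun p hp => ?_
  · suffices WithLp.toLp 2 p ∈ Tᗮᗮ by rwa [T.orthogonal_orthogonal] at this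
    intro u hu
    have hu' : (u.snd, -u.fst) ∈ S.adjoint := by
      refine (Submodule.mem_adjoint_iff _ _).2 fun a b hab => ?_
      have := hu (WithLp.toLp 2 (a, b)) hab
      rw [WithLp.prod_inner_apply] at this
      rw [inner_neg_right, sub_neg_eq_add, add_comm]
      exact this
    have := (Submodule.mem_adjoint_iff _ _).1 hp _ _ hu'
    rw [inner_neg_left] at this
    rw [WithLp.prod_inner_apply, ← neg_eq_zero, neg_add']
    exact this
  · refine (Submodule.mem_adjoint_iff _ _).2 fun a b hab => ?_
    have := congrArg conj ((Submodule.mem_adjoint_iff _ _).1 hab _ _ hp)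
    rw [map_sub, inner_conj_symm, inner_conj_symm, map_zero] at this
    rw [← neg_eq_zero, neg_sub, this]

end Adjoint

section Symmetric

variable {E : Type*} [NormedAddCommGroup E] [InnerProductSpace ℂ E] {A : Submodule ℂ (E × E)}
  {f g : E} {z : ℂ}

theorem inner_self_eq_ofReal (f : E) : ⟪f, f⟫_ℂ = ((‖f‖ ^ 2 : ℝ) : ℂ) := by
  rw [inner_self_eq_norm_sq_to_K, ofReal_pow]
  rfl

theorem IsSymmetricRel.inner_eq (hA : IsSymmetricRel A) {u v : E} (hf : (f, g) ∈ A)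
    (hu : (u, v) ∈ A) : ⟪f, v⟫_ℂ = ⟪g, u⟫_ℂ :=
  (sub_eq_zero.1 ((Submodule.mem_adjoint_iff _ _).1 (hA hu) f g hf)).symm

theorem IsSymmetricRel.abs_im_mul_norm_le (hA : IsSymmetricRel A) (h : (f, g) ∈ A) (z : ℂ) :
    |z.im| * ‖f‖ ≤ ‖g - z • f‖ := by
  have hreal : (⟪f, g⟫_ℂ).im = 0 := by
    rw [← conj_eq_iff_im, inner_conj_symm, hA.inner_eq h h]
  have him : (⟪f, g - z • f⟫_ℂ).im = -(z.im * ‖f‖ ^ 2) := by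
    rw [inner_sub_right, inner_smul_right, sub_im, hreal, inner_self_eq_ofReal,
      im_mul_ofReal, zero_sub]
  have hle : |z.im| * ‖f‖ ^ 2 ≤ ‖f‖ * ‖g - z • f‖ := by
    calc |z.im| * ‖f‖ ^ 2 = |(⟪f, g - z • f⟫_ℂ).im| := by
          rw [him, abs_neg, abs_mul, abs_of_nonneg (sq_nonneg ‖f‖)]
      _ ≤ ‖⟪f, g - z • f⟫_ℂ‖ := abs_im_le_norm _
      _ ≤ ‖f‖ * ‖g - z • f‖ := norm_inner_le_norm _ _
  rcases (norm_nonneg f).eq_or_lt with hf | hf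
  · rw [← hf, mul_zero]
    exact norm_nonneg _
  · exact le_of_mul_le_mul_left (by linarith) hf

theorem IsSymmetricRel.eigenspace_eq_bot (hA : IsSymmetricRel A) (hz : z.im ≠ 0) :
    eigenspace A z = ⊥ := by
  refine (Submodule.eq_bot_iff _).2 fun f hf => norm_le_zero_iff.1 ?_
  have := hA.abs_im_mul_norm_le ((mem_eigenspace A z f).1 hf) z
  rw [sub_self, norm_zero] at this
  exact nonpos_of_mul_nonpos_right this (abs_pos.2 hz)

/-- The range `ran (A - z)` of a linear relation shifted by `z`. -/
def rangeSub (A : Submodule ℂ (E × E)) (z : ℂ) : Submodule ℂ E :=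
  A.map (LinearMap.snd ℂ E E - z • LinearMap.fst ℂ E E)

theorem orthogonal_rangeSub (A : Submodule ℂ (E × E)) (z : ℂ) :
    (rangeSub A z)ᗮ = eigenspace A.adjoint (conj z) := by
  ext u
  rw [mem_eigenspace, Submodule.mem_adjoint_iff, Submodule.mem_orthogonal]
  constructor
  · intro h a b hab
    have := h (b - z • a) ⟨(a, b), hab, rfl⟩
    rwa [inner_sub_left, inner_smul_left, ← inner_smul_right] at this
  · rintro h _ ⟨⟨a, b⟩, hab, rfl⟩
    have := h a b hab
    rwa [inner_smul_right, ← inner_smul_left, ← inner_sub_left] at this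

theorem IsSymmetricRel.isClosed_rangeSub [CompleteSpace E] (hA : IsSymmetricRel A)
    (hclosed : IsClosed (A : Set (E × E))) (hz : z.im ≠ 0) :
    IsClosed (rangeSub A z : Set E) := by
  let T : A →L[ℂ] E :=
    (ContinuousLinearMap.snd ℂ E E - z • ContinuousLinearMap.fst ℂ E E).comp A.subtypeL
  have hfst : ∀ p : A, ‖p.1.1‖ ≤ ‖T p‖ / |z.im| := fun p => by
    rw [le_div_iff₀ (abs_pos.2 hz), mul_comm]
    exact hA.abs_im_mul_norm_le p.2 z
  have hsnd : ∀ p : A, ‖p.1.2‖ ≤ ‖T p‖ + ‖z‖ * (‖T p‖ / |z.im|) := fun p =>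
    calc ‖p.1.2‖ = ‖T p + z • p.1.1‖ := by
          rw [show T p = p.1.2 - z • p.1.1 from rfl, sub_add_cancel]
      _ ≤ ‖T p‖ + ‖z‖ * ‖p.1.1‖ := (norm_add_le _ _).trans_eq (by rw [norm_smul])
      _ ≤ ‖T p‖ + ‖z‖ * (‖T p‖ / |z.im|) := by gcongr; exact hfst p
  have hanti : AntilipschitzWith (Real.toNNReal (1 / |z.im| + (1 + ‖z‖ / |z.im|))) T := by
    refine T.antilipschitz_of_bound fun p => ?_
    rw [Real.coe_toNNReal _ (by positivity), add_mul]
    refine max_le ((hfst p).trans ?_) ((hsnd p).trans ?_)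
    · rw [one_div_mul_eq_div]
      exact le_add_of_nonneg_right (by positivity)
    · calc ‖T p‖ + ‖z‖ * (‖T p‖ / |z.im|) = (1 + ‖z‖ / |z.im|) * ‖T p‖ := by ring
        _ ≤ 1 / |z.im| * ‖T p‖ + (1 + ‖z‖ / |z.im|) * ‖T p‖ :=
          le_add_of_nonneg_left (by positivity)
  have hrange : (rangeSub A z : Set E) = Set.range T := by
    rw [rangeSub, Submodule.map_coe]
    exact Set.image_eq_range _ _
  have : CompleteSpace A := hclosed.completeSpace_coe
  rw [hrange]
  exact hanti.isClosed_range T.uniformContinuous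

theorem isClosed_adjoint (A : Submodule ℂ (E × E)) : IsClosed (A.adjoint : Set (E × E)) := by
  have : (A.adjoint : Set (E × E)) = ⋂ q ∈ A, {p | ⟪q.2, p.1⟫_ℂ - ⟪q.1, p.2⟫_ℂ = 0} := by
    ext p
    simp
  rw [this]
  exact isClosed_biInter fun q _ => isClosed_eq (by fun_prop) continuous_const

theorem IsSelfAdjointRel.rangeSub_eq_top [CompleteSpace E] (hA : IsSelfAdjointRel A)
    (hz : z.im ≠ 0) : rangeSub A z = ⊤ := by
  have hsymm : IsSymmetricRel A := hA.ge
  have hclosed : IsClosed (A : Set (E × E)) := hA ▸ isClosed_adjoint A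
  have : CompleteSpace (rangeSub A z) := (hsymm.isClosed_rangeSub hclosed hz).completeSpace_coe
  rw [← Submodule.orthogonal_eq_bot_iff, orthogonal_rangeSub, hA]
  exact hsymm.eigenspace_eq_bot (by simpa using hz)

end Symmetric

section Simple

variable {E : Type*} [NormedAddCommGroup E] [InnerProductSpace ℂ E] {S : Submodule ℂ (E × E)}
  {K : Submodule ℂ E} {x : ℝ}

theorem IsSymmetricRel.eq_part_sup_part (hS : IsSymmetricRel S) [K.HasOrthogonalProjection]
    (hK : K ≤ eigenspace S x) : S = part S K ⊔ part S Kᗮ := by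
  refine le_antisymm ?_ (sup_le inf_le_left inf_le_left)
  rintro ⟨u, v⟩ huv
  set a : E := K.starProjection u
  have ha : a ∈ K := K.starProjection_apply_mem u
  have hsub : u - a ∈ Kᗮ := K.sub_starProjection_mem_orthogonal u
  have hsub' : v - (x : ℂ) • a ∈ Kᗮ := fun k hk => by
    rw [inner_sub_right, hS.inner_eq ((mem_eigenspace S x k).1 (hK hk)) huv, inner_smul_left,
      conj_ofReal, inner_smul_right, ← mul_sub, ← inner_sub_right, hsub k hk, mul_zero]
  refine Submodule.mem_sup.2 ⟨_, ⟨hK ha, ha, K.smul_mem _ ha⟩, _,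
    ⟨S.sub_mem huv (hK ha), hsub, hsub'⟩, ?_⟩
  rw [Prod.mk_sub_mk, Prod.mk_add_mk, add_sub_cancel, add_sub_cancel]

theorem IsSymmetricRel.mem_partIn_iff (hS : IsSymmetricRel S) (hK : K ≤ eigenspace S x)
    {a b : K} : (a, b) ∈ partIn S K ↔ b = (x : ℂ) • a := by
  refine ⟨fun (hab : ((a : E), (b : E)) ∈ S) => ext_inner_left ℂ fun k => ?_, ?_⟩
  · rw [inner_smul_right, Submodule.coe_inner,
      hS.inner_eq ((mem_eigenspace S x k).1 (hK k.2)) hab, inner_smul_left, conj_ofReal,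
      Submodule.coe_inner]
  · rintro rfl
    exact hK a.2

theorem IsSymmetricRel.isSelfAdjointRel_partIn (hS : IsSymmetricRel S)
    (hK : K ≤ eigenspace S x) : IsSelfAdjointRel (partIn S K) := by
  ext ⟨a, b⟩
  have hinner (k : K) : ⟪(x : ℂ) • k, a⟫_ℂ = ⟪k, (x : ℂ) • a⟫_ℂ := by
    rw [inner_smul_left, conj_ofReal, inner_smul_right]
  simp only [Submodule.mem_adjoint_iff, hS.mem_partIn_iff hK, sub_eq_zero]
  constructor
  · exact fun h => ext_inner_left ℂ fun k => by rw [← h k _ rfl, hinner]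
  · rintro rfl k _ rfl
    exact hinner k

theorem IsSimpleRel.notMem_pointSpectrum (hsimple : IsSimpleRel S) (hS : IsSymmetricRel S)
    (x : ℝ) : (x : ℂ) ∉ pointSpectrum S := by
  refine not_not_intro ((Submodule.eq_bot_iff _).2 fun f hf => ?_)
  have hspan : ℂ ∙ f ≤ eigenspace S x := (Submodule.span_singleton_le_iff_mem _ _).2 hf
  exact Submodule.span_singleton_eq_bot.1 <|
    hsimple (ℂ ∙ f) (Submodule.closed_of_finiteDimensional _) (hS.eq_part_sup_part hspan)
      (hS.isSelfAdjointRel_partIn hspan)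

end Simple

section Unitary

variable {E B : Type*} [NormedAddCommGroup E] [InnerProductSpace ℂ E] [NormedAddCommGroup B]
  [InnerProductSpace ℂ B] {S : Submodule ℂ (E × E)} {Γ : Submodule ℂ ((E × E) × (B × B))}
  {z w : ℂ} {f g : E} {α β α' β' : B}

/-- `Γ ⊆ E² × B²` is a unitary relation between the Krein spaces `E²` and `B²`, that is, it
coincides with its own orthogonal companion with respect to Green's identity. -/
def IsUnitaryRel (Γ : Submodule ℂ ((E × E) × (B × B))) : Prop :=
  ∀ q, q ∈ Γ ↔ ∀ p ∈ Γ, Green p q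

theorem IsBoundaryRelation.isUnitaryRel (hΓ : IsBoundaryRelation S Γ) : IsUnitaryRel Γ :=
  fun q => ⟨fun hq p hp => hΓ.green p hp q hq, hΓ.maximal q⟩

/-- The kernel `{(f; g) : ((f; g); (0; 0)) ∈ Γ}`; for a boundary relation for `S*` this is `S`. -/
def kernel (Γ : Submodule ℂ ((E × E) × (B × B))) : Submodule ℂ (E × E) :=
  Γ.comap (LinearMap.inl ℂ (E × E) (B × B))

theorem IsBoundaryRelation.kernel_eq [CompleteSpace E] (hΓ : IsBoundaryRelation S Γ)
    (hS : IsClosed (S : Set (E × E))) : kernel Γ = S := by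
  refine le_antisymm (fun p (hp : (p, 0) ∈ Γ) => ?_) fun p hp =>
    show (p, 0) ∈ Γ from hΓ.maximal _ fun q hq => ?_
  · rw [← adjoint_adjoint_of_isClosed hS, Submodule.mem_adjoint_iff]
    intro a b hab
    have hclosed : IsClosed {q : E × E | ⟪q.2, p.1⟫_ℂ - ⟪q.1, p.2⟫_ℂ = 0} :=
      isClosed_eq (by fun_prop) continuous_const
    refine closure_minimal ?_ hclosed (hΓ.dom_dense hab)
    rintro _ ⟨q, hq, rfl⟩
    have hgreen : ⟪q.1.1, p.2⟫_ℂ - ⟪q.1.2, p.1⟫_ℂ = 0 := by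
      simpa [Green] using hΓ.green _ hp q hq
    rw [Set.mem_ofPred_eq, ← neg_eq_zero, neg_sub, hgreen]
  · have hadj := (Submodule.mem_adjoint_iff _ _).1 (hΓ.dom_le q hq) p.1 p.2 hp
    simp only [Green, Prod.fst_zero, Prod.snd_zero, inner_zero_left, sub_zero]
    rw [← neg_sub, hadj, neg_zero]

theorem green_comm {p q : (E × E) × (B × B)} : Green p q ↔ Green q p := by
  have hsymm : ∀ {p q : (E × E) × (B × B)}, Green p q → Green q p := fun {p q} h => by
    have := congrArg conj h
    simp only [map_sub, inner_conj_symm] at this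
    unfold Green
    linear_combination -this
  exact ⟨hsymm, hsymm⟩

theorem IsUnitaryRel.isClosed (hΓ : IsUnitaryRel Γ) :
    IsClosed (Γ : Set ((E × E) × (B × B))) := by
  have : (Γ : Set ((E × E) × (B × B))) = ⋂ p ∈ Γ, {q | Green p q} := by
    ext q
    simp only [SetLike.mem_coe, hΓ q, Set.mem_iInter, Set.mem_ofPred_eq]
  rw [this]
  refine isClosed_biInter fun p _ => ?_
  unfold Green
  exact isClosed_eq (by fun_prop) (by fun_prop)

theorem IsUnitaryRel.isSymmetricRel_kerPi₁ (hΓ : IsUnitaryRel Γ) : IsSymmetricRel (kerPi₁ Γ) := by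
  rintro p ⟨β, hp⟩
  refine (Submodule.mem_adjoint_iff _ _).2 fun a b ⟨β', hab⟩ => ?_
  have hgreen : ⟪a, p.2⟫_ℂ - ⟪b, p.1⟫_ℂ = 0 := by
    simpa [Green] using (hΓ _).1 hab _ hp
  rw [← neg_eq_zero, neg_sub, hgreen]

/-- The main transform of `Γ` (Derkach, Hassi, Malamud, de Snoo): the relation
`{((f, α); (g, -β)) : ((f; g); (α; β)) ∈ Γ}` in the Hilbert space `E × B`, which turns unitary
relations between Krein spaces into selfadjoint relations. -/
def mainTransform (Γ : Submodule ℂ ((E × E) × (B × B))) :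
    Submodule ℂ (WithLp 2 (E × B) × WithLp 2 (E × B)) where
  carrier := {p | ((p.1.fst, p.2.fst), (p.1.snd, -p.2.snd)) ∈ Γ}
  zero_mem' := by
    change ((0, 0), (0, -0)) ∈ Γ
    rw [neg_zero]
    exact Γ.zero_mem
  add_mem' hp hq := by simpa [add_comm] using Γ.add_mem hp hq
  smul_mem' c p hp := by simpa using Γ.smul_mem c hp

theorem IsUnitaryRel.isSelfAdjointRel_mainTransform (hΓ : IsUnitaryRel Γ) :
    IsSelfAdjointRel (mainTransform Γ) := by
  ext ⟨u, v⟩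
  refine (Submodule.mem_adjoint_iff _ _).trans (Iff.trans ?_ (hΓ _).symm)
  have hgreen (a b : WithLp 2 (E × B)) : ⟪b, u⟫_ℂ - ⟪a, v⟫_ℂ = 0 ↔
      Green ((a.fst, b.fst), (a.snd, -b.snd)) ((u.fst, v.fst), (u.snd, -v.snd)) := by
    have hinner (u v : WithLp 2 (E × B)) : ⟪u, v⟫_ℂ = ⟪u.fst, v.fst⟫_ℂ + ⟪u.snd, v.snd⟫_ℂ :=
      WithLp.prod_inner_apply u v
    rw [green_comm]
    simp only [Green, hinner, inner_neg_left, inner_neg_right]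
    constructor <;> intro h <;> linear_combination -h
  constructor
  · rintro h ⟨⟨a, b⟩, α, β⟩ hp
    simpa using (hgreen (WithLp.toLp 2 (a, α)) (WithLp.toLp 2 (b, -β))).1
      (h _ _ (show ((a, b), (α, - -β)) ∈ Γ by rwa [neg_neg]))
  · exact fun h a b hab => (hgreen a b).2 (h _ hab)

/-- The solutions `(f, α, β)` of `((f; z f); (α; β)) ∈ Γ`: the defect elements of `Γ` at `z`
together with their boundary values. The Weyl family consists of the pairs `(α; β)`. -/
def solutionSpace (Γ : Submodule ℂ ((E × E) × (B × B))) (z : ℂ) : Submodule ℂ (E × B × B) :=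
  Γ.comap ((LinearMap.id.prod (z • LinearMap.id)).prodMap LinearMap.id)

theorem mem_solutionSpace : (f, α, β) ∈ solutionSpace Γ z ↔ ((f, z • f), (α, β)) ∈ Γ :=
  Iff.rfl

theorem IsUnitaryRel.inner_solution (hΓ : IsUnitaryRel Γ) (hf : (f, α, β) ∈ solutionSpace Γ z)
    (hg : (g, α', β') ∈ solutionSpace Γ w) :
    (z - conj w) * ⟪g, f⟫_ℂ = ⟪α', β⟫_ℂ - ⟪β', α⟫_ℂ := by
  have h : ⟪g, z • f⟫_ℂ - ⟪w • g, f⟫_ℂ = ⟪α', β⟫_ℂ - ⟪β', α⟫_ℂ :=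
    (hΓ _).1 hg _ hf
  rw [sub_mul, ← h, inner_smul_left, inner_smul_right]

theorem IsUnitaryRel.exists_mem_solutionSpace [CompleteSpace E] [CompleteSpace B]
    (hΓ : IsUnitaryRel Γ) (hz : z.im ≠ 0) (b : B) :
    ∃ f α, (f, α, -(b + z • α)) ∈ solutionSpace Γ z := by
  have hb : WithLp.toLp 2 (0, b) ∈ rangeSub (mainTransform Γ) z := by
    rw [hΓ.isSelfAdjointRel_mainTransform.rangeSub_eq_top hz]
    exact Submodule.mem_top
  obtain ⟨⟨u, v⟩, huv, hsub⟩ := hb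
  have hfst : v.fst = z • u.fst := sub_eq_zero.1 (congrArg WithLp.fst hsub)
  have hsnd : v.snd = b + z • u.snd := sub_eq_iff_eq_add.1 (congrArg WithLp.snd hsub)
  refine ⟨u.fst, u.snd, ?_⟩
  rw [mem_solutionSpace, ← hfst, ← hsnd]
  exact huv

theorem IsUnitaryRel.mem_solutionSpace_of_tendsto (hΓ : IsUnitaryRel Γ) {ι : Type*} {l : Filter ι}
    [l.NeBot] {ζ : ι → ℂ} {φ : ι → E} {a b : ι → B} (hζ : Tendsto ζ l (𝓝 z))
    (hφ : Tendsto φ l (𝓝 f)) (ha : Tendsto a l (𝓝 α)) (hb : Tendsto b l (𝓝 β))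
    (h : ∀ᶠ i in l, (φ i, a i, b i) ∈ solutionSpace Γ (ζ i)) : (f, α, β) ∈ solutionSpace Γ z :=
  hΓ.isClosed.mem_of_tendsto
    ((hφ.prodMk_nhds (hζ.smul hφ)).prodMk_nhds (ha.prodMk_nhds hb)) h

theorem eq_zero_of_mem_solutionSpace (hz : z ∉ pointSpectrum (kernel Γ))
    (hf : (f, 0, 0) ∈ solutionSpace Γ z) : f = 0 :=
  (Submodule.eq_bot_iff _).1 (not_not.1 hz) f hf

theorem mem_pointSpectrum_kerPi₁_iff :
    z ∈ pointSpectrum (kerPi₁ Γ) ↔ ∃ f β, f ≠ 0 ∧ (f, 0, β) ∈ solutionSpace Γ z := by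
  refine (Submodule.ne_bot_iff _).trans ⟨?_, ?_⟩
  · rintro ⟨f, ⟨β, hβ⟩, hf⟩
    exact ⟨f, β, hf, hβ⟩
  · rintro ⟨f, β, hf, hβ⟩
    exact ⟨f, ⟨β, hβ⟩, hf⟩

end Unitary

section WeylFunction

variable {E : Type*} [NormedAddCommGroup E] [InnerProductSpace ℂ E]
  {Γ : Submodule ℂ ((E × E) × (ℂ × ℂ))} {z w : ℂ}

theorem IsUnitaryRel.weylFunction_mem_weylFamily [CompleteSpace E] (hΓ : IsUnitaryRel Γ)
    (hfun : IsFunctionType Γ) (hz : z.im ≠ 0) : (1, weylFunction Γ z) ∈ weylFamily Γ z := by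
  suffices ∃ β : ℂ, (1, β) ∈ weylFamily Γ z from Classical.epsilon_spec this
  obtain ⟨f, α, hf⟩ := hΓ.exists_mem_solutionSpace hz 1
  have hα : α ≠ 0 := by
    rintro rfl
    have hbot : f ∈ eigenspace (kerPi₁ Γ) z := ⟨_, hf⟩
    rw [hΓ.isSymmetricRel_kerPi₁.eigenspace_eq_bot hz, Submodule.mem_bot] at hbot
    rw [hbot, mem_solutionSpace, smul_zero] at hf
    simpa using hfun _ hf
  have := (solutionSpace Γ z).smul_mem α⁻¹ hf
  rw [Prod.smul_mk, Prod.smul_mk, smul_eq_mul, inv_mul_cancel₀ hα] at this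
  exact ⟨_, _, this⟩

/-- The `γ`-field: `gammaField Γ z` is an element `f` with `((f; z f); (1; m(z))) ∈ Γ`, where `m` is
the Weyl function. It is meaningful for nonreal `z`. -/
noncomputable def gammaField (Γ : Submodule ℂ ((E × E) × (ℂ × ℂ))) (z : ℂ) : E :=
  Classical.epsilon fun f => (f, 1, weylFunction Γ z) ∈ solutionSpace Γ z

variable [CompleteSpace E] (hΓ : IsUnitaryRel Γ) (hfun : IsFunctionType Γ)

include hΓ hfun

theorem IsUnitaryRel.gammaField_mem (hz : z.im ≠ 0) :
    (gammaField Γ z, 1, weylFunction Γ z) ∈ solutionSpace Γ z :=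
  Classical.epsilon_spec (p := fun f => (f, 1, weylFunction Γ z) ∈ solutionSpace Γ z)
    (hΓ.weylFunction_mem_weylFamily hfun hz)

theorem IsUnitaryRel.inner_gammaField (hz : z.im ≠ 0) (hw : w.im ≠ 0) :
    (z - conj w) * ⟪gammaField Γ w, gammaField Γ z⟫_ℂ =
      weylFunction Γ z - conj (weylFunction Γ w) := by
  rw [hΓ.inner_solution (hΓ.gammaField_mem hfun hz) (hΓ.gammaField_mem hfun hw)]
  simp

theorem IsUnitaryRel.im_weylFunction (hz : z.im ≠ 0) :
    (weylFunction Γ z).im = z.im * ‖gammaField Γ z‖ ^ 2 := by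
  have h := congrArg im (hΓ.inner_gammaField hfun hz hz)
  rw [inner_self_eq_ofReal, im_mul_ofReal, sub_im, conj_im, sub_im, conj_im] at h
  linarith

end WeylFunction

section Convergence

theorem exists_tendsto_of_dist_sq_le {ι X : Type*} [PseudoMetricSpace X] [CompleteSpace X]
    {l : Filter ι} [l.NeBot] {v : ι → X} {u : ι → ℝ} {c : ℝ} (hu : Tendsto u l (𝓝 c))
    (h : ∀ᶠ p in l ×ˢ l, dist (v p.1) (v p.2) ^ 2 ≤ dist (u p.1) (u p.2)) :
    ∃ g, Tendsto v l (𝓝 g) := by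
  rw [← cauchy_map_iff_exists_tendsto, cauchy_map_iff', tendsto_uniformity_iff_dist_tendsto_zero]
  have hdist : Tendsto (fun p : ι × ι => dist (u p.1) (u p.2)) (l ×ˢ l) (𝓝 0) := by
    simpa only [Function.comp_def, dist_self] using
      (hu.comp tendsto_fst).dist (hu.comp tendsto_snd)
  have hsqrt : Tendsto (fun p : ι × ι => √(dist (u p.1) (u p.2))) (l ×ˢ l) (𝓝 0) := by
    simpa only [Real.sqrt_zero] using hdist.sqrt
  refine squeeze_zero' (Eventually.of_forall fun _ => dist_nonneg) ?_ hsqrt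
  filter_upwards [h] with p hp using Real.le_sqrt_of_sq_le hp

variable {F : Type*} [SeminormedAddCommGroup F] {v : ℝ → F} {u : ℝ → ℝ}
  (h : ∀ {ε δ : ℝ}, 0 < ε → 0 < δ → (ε + δ) * ‖v ε - v δ‖ ^ 2 ≤ (ε - δ) * (u ε - u δ))

include h

theorem exists_tendsto_of_add_mul_norm_sub_sq_le [CompleteSpace F] {c : ℝ}
    (hu : Tendsto u (𝓝[>] 0) (𝓝 c)) : ∃ g, Tendsto v (𝓝[>] 0) (𝓝 g) := by
  refine exists_tendsto_of_dist_sq_le hu ?_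
  have hpos : ∀ᶠ ε : ℝ in 𝓝[>] 0, 0 < ε := self_mem_nhdsWithin
  filter_upwards [hpos.prod_mk hpos] with ⟨ε, δ⟩ ⟨hε, hδ⟩
  have hle : |ε - δ| ≤ ε + δ := abs_le.2 ⟨by linarith, by linarith⟩
  rw [dist_eq_norm, Real.dist_eq]
  refine le_of_mul_le_mul_left ?_ (add_pos hε hδ)
  calc (ε + δ) * ‖v ε - v δ‖ ^ 2 ≤ |(ε - δ) * (u ε - u δ)| := (h hε hδ).trans (le_abs_self _)
    _ = |ε - δ| * |u ε - u δ| := abs_mul _ _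
    _ ≤ (ε + δ) * |u ε - u δ| := mul_le_mul_of_nonneg_right hle (abs_nonneg _)

theorem monotoneOn_of_add_mul_norm_sub_sq_le : MonotoneOn u (Set.Ioi 0) := by
  intro ε (hε : 0 < ε) δ (hδ : 0 < δ) hle
  rcases hle.eq_or_lt with rfl | hlt
  · exact le_rfl
  · have hnonneg : 0 ≤ (δ - ε) * (u δ - u ε) := le_trans (by positivity) (h hδ hε)
    exact sub_nonneg.1 (nonneg_of_mul_nonneg_right hnonneg (sub_pos.2 hlt))

theorem exists_tendsto_of_add_mul_norm_sub_sq_le_of_bddBelow [CompleteSpace F]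
    (hu : BddBelow (u '' Set.Ioi 0)) : ∃ g, Tendsto v (𝓝[>] 0) (𝓝 g) :=
  exists_tendsto_of_add_mul_norm_sub_sq_le h
    ((monotoneOn_of_add_mul_norm_sub_sq_le h).tendsto_nhdsGT hu)

end Convergence

section VerticalRay

variable {E : Type*} [NormedAddCommGroup E] [InnerProductSpace ℂ E] [CompleteSpace E]
  {Γ : Submodule ℂ ((E × E) × (ℂ × ℂ))} {ε δ : ℝ}

theorem im_add_I_mul (x ε : ℝ) : ((x : ℂ) + I * ε).im = ε := by
  simp

theorem tendsto_ofReal_nhdsGT_zero : Tendsto (fun ε : ℝ => (ε : ℂ)) (𝓝[>] 0) (𝓝 0) :=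
  (continuous_ofReal.tendsto' 0 0 ofReal_zero).mono_left nhdsWithin_le_nhds

theorem tendsto_add_I_mul (x : ℝ) : Tendsto (fun ε : ℝ => (x : ℂ) + I * ε) (𝓝[>] 0) (𝓝 x) := by
  simpa only [mul_zero, add_zero] using (tendsto_ofReal_nhdsGT_zero.const_mul I).const_add (x : ℂ)

variable (hΓ : IsUnitaryRel Γ) (hfun : IsFunctionType Γ) (x : ℝ)

include hΓ hfun

theorem IsUnitaryRel.gammaField_add_I_mul_mem (hε : 0 < ε) :
    (gammaField Γ (x + I * ε), 1, weylFunction Γ (x + I * ε)) ∈ solutionSpace Γ (x + I * ε) :=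
  hΓ.gammaField_mem hfun ((im_add_I_mul x ε).trans_ne hε.ne')

theorem IsUnitaryRel.im_weylFunction_add_I_mul (hε : 0 < ε) :
    (weylFunction Γ (x + I * ε)).im = ε * ‖gammaField Γ (x + I * ε)‖ ^ 2 := by
  rw [hΓ.im_weylFunction hfun ((im_add_I_mul x ε).trans_ne hε.ne'), im_add_I_mul]

theorem IsUnitaryRel.inner_gammaField_add_I_mul (hε : 0 < ε) (hδ : 0 < δ) :
    I * (ε + δ) * ⟪gammaField Γ (x + I * δ), gammaField Γ (x + I * ε)⟫_ℂ =
      weylFunction Γ (x + I * ε) - conj (weylFunction Γ (x + I * δ)) := by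
  rw [← hΓ.inner_gammaField hfun ((im_add_I_mul x ε).trans_ne hε.ne')
    ((im_add_I_mul x δ).trans_ne hδ.ne')]
  simp only [map_add, map_mul, conj_ofReal, conj_I]
  ring

theorem IsUnitaryRel.add_mul_re_inner_gammaField (hε : 0 < ε) (hδ : 0 < δ) :
    (ε + δ) * (⟪gammaField Γ (x + I * δ), gammaField Γ (x + I * ε)⟫_ℂ).re =
      ε * ‖gammaField Γ (x + I * ε)‖ ^ 2 + δ * ‖gammaField Γ (x + I * δ)‖ ^ 2 := by
  have h := congrArg im (hΓ.inner_gammaField_add_I_mul hfun x hε hδ)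
  rw [sub_im, conj_im, sub_neg_eq_add, hΓ.im_weylFunction_add_I_mul hfun x hε,
    hΓ.im_weylFunction_add_I_mul hfun x hδ, mul_assoc, I_mul_im, ← ofReal_add,
    re_ofReal_mul] at h
  exact h

theorem IsUnitaryRel.add_mul_norm_gammaField_sub_sq (hε : 0 < ε) (hδ : 0 < δ) :
    (ε + δ) * ‖gammaField Γ (x + I * ε) - gammaField Γ (x + I * δ)‖ ^ 2 =
      (ε - δ) * (-‖gammaField Γ (x + I * ε)‖ ^ 2 - -‖gammaField Γ (x + I * δ)‖ ^ 2) := by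
  have h := hΓ.add_mul_re_inner_gammaField hfun x hε hδ
  rw [norm_sub_rev, norm_sub_sq (𝕜 := ℂ), RCLike.re_to_complex]
  linear_combination -2 * h

theorem IsUnitaryRel.add_mul_norm_smul_gammaField_sub_sq (hε : 0 < ε) (hδ : 0 < δ) :
    (ε + δ) * ‖(ε : ℂ) • gammaField Γ (x + I * ε) - (δ : ℂ) • gammaField Γ (x + I * δ)‖ ^ 2 =
      (ε - δ) * ((ε * ‖gammaField Γ (x + I * ε)‖) ^ 2 -
        (δ * ‖gammaField Γ (x + I * δ)‖) ^ 2) := by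
  have h := hΓ.add_mul_re_inner_gammaField hfun x hε hδ
  rw [norm_sub_rev, norm_sub_sq (𝕜 := ℂ), RCLike.re_to_complex, inner_smul_left,
    inner_smul_right, conj_ofReal, re_ofReal_mul, re_ofReal_mul, norm_smul, norm_smul, norm_real,
    norm_real, Real.norm_of_nonneg hε.le, Real.norm_of_nonneg hδ.le]
  linear_combination -2 * ε * δ * h

theorem IsUnitaryRel.exists_tendsto_gammaField_of_tendsto_norm_sq {c : ℝ}
    (hc : Tendsto (fun ε : ℝ => ‖gammaField Γ (x + I * ε)‖ ^ 2) (𝓝[>] 0) (𝓝 c)) :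
    ∃ g, Tendsto (fun ε : ℝ => gammaField Γ (x + I * ε)) (𝓝[>] 0) (𝓝 g) :=
  exists_tendsto_of_add_mul_norm_sub_sq_le
    (fun hε hδ => (hΓ.add_mul_norm_gammaField_sub_sq hfun x hε hδ).le) hc.neg

theorem IsUnitaryRel.exists_tendsto_gammaField_of_norm_le {C : ℝ}
    (hC : ∀ {ε : ℝ}, 0 < ε → ‖gammaField Γ (x + I * ε)‖ ≤ C) :
    ∃ g, Tendsto (fun ε : ℝ => gammaField Γ (x + I * ε)) (𝓝[>] 0) (𝓝 g) := by
  refine exists_tendsto_of_add_mul_norm_sub_sq_le_of_bddBelow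
    (fun hε hδ => (hΓ.add_mul_norm_gammaField_sub_sq hfun x hε hδ).le) ⟨-C ^ 2, ?_⟩
  rintro _ ⟨ε, hε, rfl⟩
  exact neg_le_neg (pow_le_pow_left₀ (norm_nonneg _) (hC hε) 2)

theorem IsUnitaryRel.exists_tendsto_smul_gammaField :
    ∃ g, Tendsto (fun ε : ℝ => (ε : ℂ) • gammaField Γ (x + I * ε)) (𝓝[>] 0) (𝓝 g) := by
  refine exists_tendsto_of_add_mul_norm_sub_sq_le_of_bddBelow
    (fun hε hδ => (hΓ.add_mul_norm_smul_gammaField_sub_sq hfun x hε hδ).le) ⟨0, ?_⟩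
  rintro _ ⟨ε, -, rfl⟩
  exact sq_nonneg _

variable {x} {g : E}
  (hg : Tendsto (fun ε : ℝ => (ε : ℂ) • gammaField Γ (x + I * ε)) (𝓝[>] 0) (𝓝 g))

include hg

theorem IsUnitaryRel.tendsto_mul_im_weylFunction :
    Tendsto (fun ε : ℝ => ε * (weylFunction Γ (x + I * ε)).im) (𝓝[>] 0) (𝓝 (‖g‖ ^ 2)) := by
  refine (hg.norm.pow 2).congr' ?_
  filter_upwards [self_mem_nhdsWithin] with ε (hε : 0 < ε)
  rw [hΓ.im_weylFunction_add_I_mul hfun x hε, norm_smul, norm_real, Real.norm_of_nonneg hε.le]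
  ring

theorem IsUnitaryRel.exists_tendsto_mul_weylFunction :
    ∃ μ, Tendsto (fun ε : ℝ => (ε : ℂ) * weylFunction Γ (x + I * ε)) (𝓝[>] 0) (𝓝 μ) := by
  have hlim : Tendsto (fun ε : ℝ => I * ((ε : ℂ) + (1 : ℝ)) *
      ⟪gammaField Γ (x + I * (1 : ℝ)), (ε : ℂ) • gammaField Γ (x + I * ε)⟫_ℂ +
        ε * conj (weylFunction Γ (x + I * (1 : ℝ)))) (𝓝[>] 0) (𝓝 _) :=
    (((tendsto_ofReal_nhdsGT_zero.add_const _).const_mul I).mul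
      (tendsto_const_nhds.inner hg)).add (tendsto_ofReal_nhdsGT_zero.mul_const _)
  refine ⟨_, hlim.congr' ?_⟩
  filter_upwards [self_mem_nhdsWithin] with ε hε
  rw [inner_smul_right]
  linear_combination (ε : ℂ) * hΓ.inner_gammaField_add_I_mul hfun x hε one_pos

theorem IsUnitaryRel.exists_mem_solutionSpace_of_tendsto_smul_gammaField :
    ∃ μ, (g, 0, μ) ∈ solutionSpace Γ x := by
  obtain ⟨μ, hμ⟩ := hΓ.exists_tendsto_mul_weylFunction hfun hg
  refine ⟨μ, hΓ.mem_solutionSpace_of_tendsto (tendsto_add_I_mul x) hg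
    tendsto_ofReal_nhdsGT_zero hμ ?_⟩
  filter_upwards [self_mem_nhdsWithin] with ε hε
  have := (solutionSpace Γ _).smul_mem (ε : ℂ) (hΓ.gammaField_add_I_mul_mem hfun x hε)
  rwa [Prod.smul_mk, Prod.smul_mk, smul_eq_mul, mul_one, smul_eq_mul] at this

end VerticalRay

section RealPoint

variable {E : Type*} [NormedAddCommGroup E] [InnerProductSpace ℂ E]
  {Γ : Submodule ℂ ((E × E) × (ℂ × ℂ))} {x ε : ℝ} {f : E} {α β : ℂ}

theorem exists_mem_solutionSpace_zero_one {z : ℂ} (hker : z ∉ pointSpectrum (kernel Γ))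
    (hz : z ∈ pointSpectrum (kerPi₁ Γ)) : ∃ f, (f, 0, 1) ∈ solutionSpace Γ z := by
  obtain ⟨f, β, hf, hfβ⟩ := mem_pointSpectrum_kerPi₁_iff.1 hz
  have hβ : β ≠ 0 := by
    rintro rfl
    exact hf (eq_zero_of_mem_solutionSpace hker hfβ)
  have := (solutionSpace Γ z).smul_mem β⁻¹ hfβ
  rw [Prod.smul_mk, Prod.smul_mk, smul_zero, smul_eq_mul, inv_mul_cancel₀ hβ] at this
  exact ⟨_, this⟩

theorem IsUnitaryRel.fst_eq_zero_of_mem_pointSpectrum (hΓ : IsUnitaryRel Γ)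
    (hker : (x : ℂ) ∉ pointSpectrum (kernel Γ)) (hx : (x : ℂ) ∈ pointSpectrum (kerPi₁ Γ))
    (hf : (f, α, β) ∈ solutionSpace Γ x) : α = 0 := by
  obtain ⟨g, hg⟩ := exists_mem_solutionSpace_zero_one hker hx
  simpa using hΓ.inner_solution hf hg

theorem IsUnitaryRel.conj_eq_of_mem_solutionSpace (hΓ : IsUnitaryRel Γ)
    (hf : (f, 1, β) ∈ solutionSpace Γ x) : conj β = β := by
  have h := hΓ.inner_solution hf hf
  rw [conj_ofReal, sub_self, zero_mul, eq_comm, sub_eq_zero] at h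
  simpa using h.symm

variable [CompleteSpace E] (hΓ : IsUnitaryRel Γ) (hfun : IsFunctionType Γ)

include hΓ hfun

theorem IsUnitaryRel.inner_solution_gammaField (hf : (f, α, β) ∈ solutionSpace Γ x) (hε : 0 < ε) :
    I * ε * ⟪f, gammaField Γ (x + I * ε)⟫_ℂ =
      weylFunction Γ (x + I * ε) * conj α - conj β := by
  have h := hΓ.inner_solution (hΓ.gammaField_add_I_mul_mem hfun x hε) hf
  rwa [conj_ofReal, add_sub_cancel_left, RCLike.inner_apply, RCLike.inner_apply, one_mul] at h

theorem IsUnitaryRel.inner_eq_I_of_tendsto_smul_gammaField (hf : (f, 0, 1) ∈ solutionSpace Γ x)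
    {g : E} (hg : Tendsto (fun ε : ℝ => (ε : ℂ) • gammaField Γ (x + I * ε)) (𝓝[>] 0) (𝓝 g)) :
    ⟪f, g⟫_ℂ = I := by
  refine tendsto_nhds_unique (tendsto_const_nhds.inner hg) (tendsto_const_nhds.congr' ?_)
  filter_upwards [self_mem_nhdsWithin] with ε hε
  have h := hΓ.inner_solution_gammaField hfun hf hε
  rw [map_zero, map_one, mul_zero, zero_sub] at h
  rw [inner_smul_right]
  linear_combination I * h - (ε : ℂ) * ⟪f, gammaField Γ (x + I * ε)⟫_ℂ * I_mul_I

theorem IsUnitaryRel.mem_pointSpectrum_kerPi₁_iff_tendsto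
    (hker : (x : ℂ) ∉ pointSpectrum (kernel Γ)) :
    (x : ℂ) ∈ pointSpectrum (kerPi₁ Γ) ↔ ∃ c : ℝ, 0 < c ∧
      Tendsto (fun ε : ℝ => ε * (weylFunction Γ (x + I * ε)).im) (𝓝[>] 0) (𝓝 c) := by
  obtain ⟨g, hg⟩ := hΓ.exists_tendsto_smul_gammaField hfun x
  have hlim := hΓ.tendsto_mul_im_weylFunction hfun hg
  constructor
  · intro hx
    obtain ⟨f, hf⟩ := exists_mem_solutionSpace_zero_one hker hx
    have hne : g ≠ 0 := by
      rintro rfl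
      have h := hΓ.inner_eq_I_of_tendsto_smul_gammaField hfun hf hg
      rw [inner_zero_right] at h
      exact I_ne_zero h.symm
    exact ⟨‖g‖ ^ 2, by positivity, hlim⟩
  · rintro ⟨c, hc, hlim'⟩
    obtain ⟨μ, hμ⟩ := hΓ.exists_mem_solutionSpace_of_tendsto_smul_gammaField hfun hg
    refine mem_pointSpectrum_kerPi₁_iff.2 ⟨g, μ, ?_, hμ⟩
    rintro rfl
    have h := tendsto_nhds_unique hlim hlim'
    rw [norm_zero, zero_pow two_ne_zero] at h
    exact hc.ne h

theorem IsUnitaryRel.mem_solutionSpace_of_tendsto_gammaField {g : E}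
    (hg : Tendsto (fun ε : ℝ => gammaField Γ (x + I * ε)) (𝓝[>] 0) (𝓝 g))
    (hβ : Tendsto (fun ε : ℝ => weylFunction Γ (x + I * ε)) (𝓝[>] 0) (𝓝 β)) :
    (g, 1, β) ∈ solutionSpace Γ x := by
  refine hΓ.mem_solutionSpace_of_tendsto (tendsto_add_I_mul x) hg tendsto_const_nhds hβ ?_
  filter_upwards [self_mem_nhdsWithin] with ε hε using hΓ.gammaField_add_I_mul_mem hfun x hε

section Solution

variable (hf : (f, 1, β) ∈ solutionSpace Γ x)

include hf

theorem IsUnitaryRel.weylFunction_sub_eq_mul_inner (hε : 0 < ε) :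
    weylFunction Γ (x + I * ε) - β = I * ε * ⟪f, gammaField Γ (x + I * ε)⟫_ℂ := by
  rw [hΓ.inner_solution_gammaField hfun hf hε, map_one, mul_one,
    hΓ.conj_eq_of_mem_solutionSpace hf]

theorem IsUnitaryRel.norm_gammaField_le (hε : 0 < ε) :
    ‖gammaField Γ (x + I * ε)‖ ≤ ‖f‖ := by
  have him := congrArg im (hΓ.weylFunction_sub_eq_mul_inner hfun hf hε)
  rw [sub_im, hΓ.im_weylFunction_add_I_mul hfun x hε,
    conj_eq_iff_im.1 (hΓ.conj_eq_of_mem_solutionSpace hf), sub_zero, mul_assoc, I_mul_im,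
    re_ofReal_mul] at him
  have hsq : ‖gammaField Γ (x + I * ε)‖ ^ 2 ≤ ‖f‖ * ‖gammaField Γ (x + I * ε)‖ := by
    rw [mul_left_cancel₀ hε.ne' him]
    exact (re_le_norm _).trans (norm_inner_le_norm _ _)
  rcases (norm_nonneg (gammaField Γ (x + I * ε))).eq_or_lt with h | h
  · rw [← h]
    exact norm_nonneg f
  · exact le_of_mul_le_mul_right (by rwa [← sq]) h

theorem IsUnitaryRel.tendsto_gammaField_and_weylFunction
    (hker : (x : ℂ) ∉ pointSpectrum (kernel Γ)) :
    Tendsto (fun ε : ℝ => gammaField Γ (x + I * ε)) (𝓝[>] 0) (𝓝 f) ∧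
      Tendsto (fun ε : ℝ => weylFunction Γ (x + I * ε)) (𝓝[>] 0) (𝓝 β) := by
  obtain ⟨g, hg⟩ := hΓ.exists_tendsto_gammaField_of_norm_le hfun x
    (hΓ.norm_gammaField_le hfun hf)
  have hm : Tendsto (fun ε : ℝ => weylFunction Γ (x + I * ε)) (𝓝[>] 0) (𝓝 β) := by
    have h : Tendsto (fun ε : ℝ => I * ε * ⟪f, gammaField Γ (x + I * ε)⟫_ℂ + β) (𝓝[>] 0)
        (𝓝 (I * 0 * ⟪f, g⟫_ℂ + β)) :=
      ((tendsto_ofReal_nhdsGT_zero.const_mul I).mul (tendsto_const_nhds.inner hg)).add_const β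
    rw [mul_zero, zero_mul, zero_add] at h
    refine h.congr' ?_
    filter_upwards [self_mem_nhdsWithin] with ε hε
    rw [← hΓ.weylFunction_sub_eq_mul_inner hfun hf hε, sub_add_cancel]
  have hgf : (g, 1, β) - (f, 1, β) ∈ solutionSpace Γ x := (solutionSpace Γ x).sub_mem
    (hΓ.mem_solutionSpace_of_tendsto_gammaField hfun hg hm) hf
  rw [Prod.mk_sub_mk, Prod.mk_sub_mk, sub_self, sub_self] at hgf
  rw [← sub_eq_zero.1 (eq_zero_of_mem_solutionSpace hker hgf)]
  exact ⟨hg, hm⟩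

theorem IsUnitaryRel.tendsto_weylFunction_sub_div (hker : (x : ℂ) ∉ pointSpectrum (kernel Γ)) :
    Tendsto (fun ε : ℝ => 1 / (I * ε) * (weylFunction Γ (x + I * ε) - β)) (𝓝[>] 0)
      (𝓝 ((‖f‖ ^ 2 : ℝ) : ℂ)) := by
  have h := tendsto_const_nhds (x := f).inner (𝕜 := ℂ)
    (hΓ.tendsto_gammaField_and_weylFunction hfun hf hker).1
  rw [inner_self_eq_ofReal] at h
  refine h.congr' ?_
  filter_upwards [self_mem_nhdsWithin] with ε (hε : 0 < ε)
  rw [hΓ.weylFunction_sub_eq_mul_inner hfun hf hε, ← mul_assoc,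
    one_div_mul_cancel (mul_ne_zero I_ne_zero (ofReal_ne_zero.2 hε.ne')), one_mul]

end Solution

theorem IsUnitaryRel.re_weylFunction_sub_div (b : ℝ) (hε : 0 < ε) :
    (1 / (I * ε) * (weylFunction Γ (x + I * ε) - b)).re = ‖gammaField Γ (x + I * ε)‖ ^ 2 := by
  have hinv : 1 / (I * ε) = ((ε⁻¹ : ℝ) : ℂ) * -I := by
    rw [one_div, mul_inv, inv_I, ofReal_inv, mul_comm]
  rw [hinv, mul_assoc, re_ofReal_mul, neg_mul, neg_re, I_mul_re, neg_neg, sub_im, ofReal_im,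
    sub_zero, hΓ.im_weylFunction_add_I_mul hfun x hε, inv_mul_cancel_left₀ hε.ne']

theorem IsUnitaryRel.ofReal_mem_weylFamily_of_tendsto {b d : ℝ}
    (hm : Tendsto (fun ε : ℝ => weylFunction Γ (x + I * ε)) (𝓝[>] 0) (𝓝 (b : ℂ)))
    (hd : Tendsto (fun ε : ℝ => 1 / (I * ε) * (weylFunction Γ (x + I * ε) - b)) (𝓝[>] 0)
      (𝓝 (d : ℂ))) :
    (1, (b : ℂ)) ∈ weylFamily Γ x := by
  have hnorm : Tendsto (fun ε : ℝ => ‖gammaField Γ (x + I * ε)‖ ^ 2) (𝓝[>] 0) (𝓝 d) := by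
    refine ((continuous_re.tendsto _).comp hd).congr' ?_
    filter_upwards [self_mem_nhdsWithin] with ε hε
      using hΓ.re_weylFunction_sub_div hfun b hε
  obtain ⟨g, hg⟩ := hΓ.exists_tendsto_gammaField_of_tendsto_norm_sq hfun x hnorm
  exact ⟨g, hΓ.mem_solutionSpace_of_tendsto_gammaField hfun hg hm⟩

theorem IsUnitaryRel.ofReal_mem_weylFamily_iff (hker : (x : ℂ) ∉ pointSpectrum (kernel Γ))
    (b : ℝ) :
    (1, (b : ℂ)) ∈ weylFamily Γ x ↔
      Tendsto (fun ε : ℝ => weylFunction Γ (x + I * ε)) (𝓝[>] 0) (𝓝 (b : ℂ)) ∧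
      ∃ d : ℝ, 0 ≤ d ∧ Tendsto (fun ε : ℝ => 1 / (I * ε) * (weylFunction Γ (x + I * ε) - b))
        (𝓝[>] 0) (𝓝 (d : ℂ)) := by
  constructor
  · rintro ⟨f, hf⟩
    exact ⟨(hΓ.tendsto_gammaField_and_weylFunction hfun hf hker).2, ‖f‖ ^ 2, sq_nonneg _,
      hΓ.tendsto_weylFunction_sub_div hfun hf hker⟩
  · rintro ⟨hm, d, -, hd⟩
    exact hΓ.ofReal_mem_weylFamily_of_tendsto hfun hm hd

end RealPoint

section Eigenpairs

variable {E : Type*} [NormedAddCommGroup E] [InnerProductSpace ℂ E]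
  {Γ : Submodule ℂ ((E × E) × (ℂ × ℂ))} {z : ℂ} {f : E} {β : ℂ}

theorem mem_pointSpectrum_iff_eigenMultiplicity_ne_zero {A : Submodule ℂ (E × E)} :
    z ∈ pointSpectrum A ↔ eigenMultiplicity A z ≠ 0 :=
  Submodule.rank_eq_zero.not.symm

/-- The pairs `(f, β)` with `((f; z f); (0; β)) ∈ Γ`: the elements of `ker (A - z)`, where
`A = ker (π₁ ∘ Γ)`, together with their second boundary value. -/
noncomputable def eigenpairs (Γ : Submodule ℂ ((E × E) × (ℂ × ℂ))) (z : ℂ) : Submodule ℂ (E × ℂ) :=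
  (solutionSpace Γ z).comap (LinearMap.id.prodMap (LinearMap.inr ℂ ℂ ℂ))

theorem mem_eigenpairs : (f, β) ∈ eigenpairs Γ z ↔ (f, 0, β) ∈ solutionSpace Γ z :=
  Iff.rfl

theorem IsFunctionType.eq_zero_of_mem_eigenpairs (hfun : IsFunctionType Γ)
    (h : (0, β) ∈ eigenpairs Γ z) : β = 0 := by
  rw [mem_eigenpairs, mem_solutionSpace, smul_zero] at h
  exact hfun β h

theorem injective_snd_comp_subtype_eigenpairs (hker : z ∉ pointSpectrum (kernel Γ)) :
    Function.Injective (LinearMap.snd ℂ E ℂ ∘ₗ (eigenpairs Γ z).subtype) := by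
  refine (injective_iff_map_eq_zero _).2 ?_
  rintro ⟨⟨f, β⟩, hf⟩ (rfl : β = 0)
  exact Subtype.ext (Prod.ext (eq_zero_of_mem_solutionSpace hker hf) rfl)

theorem finite_eigenpairs (hker : z ∉ pointSpectrum (kernel Γ)) :
    Module.Finite ℂ (eigenpairs Γ z) :=
  Module.Finite.of_injective _ (injective_snd_comp_subtype_eigenpairs hker)

theorem finrank_eigenpairs_eq_one (hker : z ∉ pointSpectrum (kernel Γ))
    (hz : z ∈ pointSpectrum (kerPi₁ Γ)) : Module.finrank ℂ (eigenpairs Γ z) = 1 := by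
  obtain ⟨e, he⟩ := exists_mem_solutionSpace_zero_one hker hz
  have hsurj : Function.Surjective (LinearMap.snd ℂ E ℂ ∘ₗ (eigenpairs Γ z).subtype) := fun c =>
    ⟨c • ⟨(e, 1), he⟩, mul_one c⟩
  rw [(LinearEquiv.ofBijective _ ⟨injective_snd_comp_subtype_eigenpairs hker, hsurj⟩).finrank_eq,
    Module.finrank_self]

theorem eigenpairs_eq_bot (hfun : IsFunctionType Γ) (hz : z ∉ pointSpectrum (kerPi₁ Γ)) :
    eigenpairs Γ z = ⊥ := by
  refine (Submodule.eq_bot_iff _).2 ?_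
  rintro ⟨f, β⟩ hf
  have hf0 : f = 0 := by_contra fun h => hz (mem_pointSpectrum_kerPi₁_iff.2 ⟨f, β, h, hf⟩)
  subst hf0
  rw [hfun.eq_zero_of_mem_eigenpairs hf, Prod.mk_zero_zero]

end Eigenpairs

section Paste

variable {n : ℕ} {H : Fin n → Type*} [∀ l, NormedAddCommGroup (H l)]
  [∀ l, InnerProductSpace ℂ (H l)] {Γ : ∀ l, Submodule ℂ ((H l × H l) × (ℂ × ℂ))}
  {z : ℂ} {x : ℝ} {hn : 2 ≤ n}

theorem pasteFst_eq_zero_iff {α β : Fin n → ℂ} :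
    pasteFst hn α β = 0 ↔ (∀ l, α l = α (lastIdx hn)) ∧ ∑ k, β k = 0 := by
  have hcoord : pasteFst hn α β = 0 ↔
      ∀ l, (if l = lastIdx hn then ∑ k, β k else -α l + α (lastIdx hn)) = 0 :=
    ⟨fun h l => congrArg (fun v : EuclideanSpace ℂ (Fin n) => v l) h, fun h => PiLp.ext h⟩
  rw [hcoord]
  constructor
  · refine fun h => ⟨fun l => ?_, (if_pos rfl).symm.trans (h (lastIdx hn))⟩
    by_cases hl : l = lastIdx hn
    · rw [hl]
    · have := h l
      rwa [if_neg hl, neg_add_eq_zero] at this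
  · rintro ⟨hα, hβ⟩ l
    rw [hβ, hα l, neg_add_cancel, ite_self]

theorem mem_eigenspace_pasting_iff {u : PiLp 2 H} :
    u ∈ eigenspace (pasting hn Γ) z ↔ ∃ (α : ℂ) (β : Fin n → ℂ),
      (∀ l, (u l, α, β l) ∈ solutionSpace (Γ l) z) ∧ ∑ l, β l = 0 := by
  rw [mem_eigenspace]
  constructor
  · rintro ⟨b, α, β, h, hb⟩
    obtain ⟨hα, hβ⟩ := pasteFst_eq_zero_iff.1 (congrArg Prod.fst hb).symm
    exact ⟨α (lastIdx hn), β, fun l => hα l ▸ h l, hβ⟩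
  · rintro ⟨a, β, h, hβ⟩
    refine ⟨pasteSnd hn (fun _ => a) β, fun _ => a, β, h, ?_⟩
    rw [pasteFst_eq_zero_iff.2 ⟨fun _ => rfl, hβ⟩]

section Multiplicity

/-- The sum `∑ β_l` of the second boundary values of a family of eigenpairs `(f_l, β_l)`; it
vanishes exactly when `(f_l)_l` is compatible with the interface conditions. -/
noncomputable def boundarySum (Γ : ∀ l, Submodule ℂ ((H l × H l) × (ℂ × ℂ))) (z : ℂ) :
    Module.Dual ℂ (∀ l, eigenpairs (Γ l) z) :=
  ∑ l, LinearMap.snd ℂ (H l) ℂ ∘ₗ (eigenpairs (Γ l) z).subtype ∘ₗ LinearMap.proj l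

/-- The map `(f_l, β_l)_l ↦ (f_l)_l` from families of eigenpairs to the Hilbert space product. -/
noncomputable def assemble (Γ : ∀ l, Submodule ℂ ((H l × H l) × (ℂ × ℂ))) (z : ℂ) :
    (∀ l, eigenpairs (Γ l) z) →ₗ[ℂ] PiLp 2 H :=
  (WithLp.linearEquiv 2 ℂ (∀ l, H l)).symm.toLinearMap ∘ₗ LinearMap.pi fun l =>
    LinearMap.fst ℂ (H l) ℂ ∘ₗ (eigenpairs (Γ l) z).subtype ∘ₗ LinearMap.proj l

theorem boundarySum_apply (p : ∀ l, eigenpairs (Γ l) z) :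
    boundarySum Γ z p = ∑ l, (p l).1.2 := by
  simp [boundarySum]

theorem injective_assemble (hfun : ∀ l, IsFunctionType (Γ l)) :
    Function.Injective (assemble Γ z) := by
  refine (injective_iff_map_eq_zero _).2 fun p hp => funext fun l => ?_
  have hfst : (p l).1.1 = 0 := congrArg (fun v : PiLp 2 H => v l) hp
  have hmem : ((0 : H l), (p l).1.2) ∈ eigenpairs (Γ l) z := hfst ▸ (p l).2
  exact Subtype.ext (Prod.ext hfst ((hfun l).eq_zero_of_mem_eigenpairs hmem))

theorem map_assemble_ker_boundarySum (l₀ : Fin n)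
    (hl₀ : ∀ {f α β}, (f, α, β) ∈ solutionSpace (Γ l₀) z → α = 0) :
    (LinearMap.ker (boundarySum Γ z)).map (assemble Γ z) = eigenspace (pasting hn Γ) z := by
  ext u
  rw [mem_eigenspace_pasting_iff, Submodule.mem_map]
  constructor
  · rintro ⟨p, hp, rfl⟩
    rw [LinearMap.mem_ker, boundarySum_apply] at hp
    exact ⟨0, fun l => (p l).1.2, fun l => (p l).2, hp⟩
  · rintro ⟨α, β, hu, hβ⟩
    obtain rfl : α = 0 := hl₀ (hu l₀)
    refine ⟨fun l => ⟨(u l, β l), hu l⟩, ?_, rfl⟩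
    rwa [LinearMap.mem_ker, boundarySum_apply]

theorem boundarySum_ne_zero {l₀ : Fin n} (hker : z ∉ pointSpectrum (kernel (Γ l₀)))
    (hl₀ : z ∈ pointSpectrum (kerPi₁ (Γ l₀))) : boundarySum Γ z ≠ 0 := by
  obtain ⟨e, he⟩ := exists_mem_solutionSpace_zero_one hker hl₀
  let p : eigenpairs (Γ l₀) z := ⟨(e, 1), he⟩
  intro h
  have hsum : ∑ l, (Pi.single (M := fun l => eigenpairs (Γ l) z) l₀ p l).1.2 = (0 : ℂ) := by
    rw [← boundarySum_apply, h, LinearMap.zero_apply]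
  rw [Finset.sum_eq_single l₀ (fun l _ hl => by rw [Pi.single_eq_of_ne hl]; rfl)
    fun hl => absurd (Finset.mem_univ l₀) hl, Pi.single_eq_same] at hsum
  exact one_ne_zero hsum

variable (hfun : ∀ l, IsFunctionType (Γ l))

include hfun

theorem finrank_pi_eigenpairs (hker : ∀ l, z ∉ pointSpectrum (kernel (Γ l))) :
    Module.finrank ℂ (∀ l, eigenpairs (Γ l) z) =
      {l | z ∈ pointSpectrum (kerPi₁ (Γ l))}.ncard := by
  classical
  have (l : Fin n) := finite_eigenpairs (hker l)
  rw [Module.finrank_pi_fintype, Set.ncard_eq_toFinset_card', Set.toFinset_ofPred,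
    Finset.card_filter]
  refine Finset.sum_congr rfl fun l _ => ?_
  split_ifs with hl
  · exact finrank_eigenpairs_eq_one (hker l) hl
  · rw [eigenpairs_eq_bot (hfun l) hl, finrank_bot]

theorem eigenMultiplicity_pasting_of_mem_pointSpectrum (hΓ : ∀ l, IsUnitaryRel (Γ l))
    (hker : ∀ l, (x : ℂ) ∉ pointSpectrum (kernel (Γ l)))
    (hx : ∃ l, (x : ℂ) ∈ pointSpectrum (kerPi₁ (Γ l))) :
    eigenMultiplicity (pasting hn Γ) x =
      (({l | (x : ℂ) ∈ pointSpectrum (kerPi₁ (Γ l))}.ncard - 1 : ℕ) : Cardinal) := by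
  obtain ⟨l₀, hl₀⟩ := hx
  have (l : Fin n) := finite_eigenpairs (hker l)
  have hfinrank := Module.Dual.finrank_ker_add_one_of_ne_zero (boundarySum_ne_zero (hker l₀) hl₀)
  rw [finrank_pi_eigenpairs hfun hker] at hfinrank
  rw [eigenMultiplicity, ← map_assemble_ker_boundarySum l₀
      ((hΓ l₀).fst_eq_zero_of_mem_pointSpectrum (hker l₀) hl₀),
    ← ((LinearMap.ker _).equivMapOfInjective _ (injective_assemble hfun)).rank_eq,
    ← Module.finrank_eq_rank, ← hfinrank, Nat.add_sub_cancel]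

end Multiplicity

variable (hΓ : ∀ l, IsUnitaryRel (Γ l)) (hker : ∀ l, (x : ℂ) ∉ pointSpectrum (kernel (Γ l)))

include hΓ hker

theorem eigenMultiplicity_pasting_eq_one (hbf : ∃ l, IsBoundaryFunction (Γ l)) {β : Fin n → ℂ}
    (hmem : ∀ l, (1, β l) ∈ weylFamily (Γ l) x) (hβ : ∑ l, β l = 0) :
    eigenMultiplicity (pasting hn Γ) x = 1 := by
  choose u hu using hmem
  have hu' : WithLp.toLp 2 u ∈ eigenspace (pasting hn Γ) x :=
    mem_eigenspace_pasting_iff.2 ⟨1, β, hu, hβ⟩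
  refine rank_eq_one ⟨_, hu'⟩ ?_ ?_
  · intro h
    obtain ⟨l, hl⟩ := hbf
    have hul : u l = 0 := congrArg (fun v : PiLp 2 H => v l) (Subtype.ext_iff.1 h)
    have hzero := hu l
    rw [hul, smul_zero] at hzero
    exact one_ne_zero (hl _ _ hzero).1
  · rintro ⟨w, hw⟩
    obtain ⟨α, γ, hwγ, -⟩ := mem_eigenspace_pasting_iff.1 hw
    refine ⟨α, Subtype.ext (PiLp.ext fun l => (sub_eq_zero.1 (by_contra fun hne => ?_)).symm)⟩
    have hsub : (w l, α, γ l) - α • (u l, 1, β l) ∈ solutionSpace (Γ l) x :=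
      (solutionSpace (Γ l) x).sub_mem (hwγ l) ((solutionSpace (Γ l) x).smul_mem α (hu l))
    rw [Prod.smul_mk, Prod.smul_mk, smul_eq_mul, mul_one, Prod.mk_sub_mk, Prod.mk_sub_mk,
      sub_self] at hsub
    exact one_ne_zero ((hΓ l).fst_eq_zero_of_mem_pointSpectrum (hker l)
      (mem_pointSpectrum_kerPi₁_iff.2 ⟨_, _, hne, hsub⟩) (hu l))

theorem alternativeOverlap_or_of_mem_pointSpectrum_pasting (hfun : ∀ l, IsFunctionType (Γ l))
    (hx : (x : ℂ) ∈ pointSpectrum (pasting hn Γ)) :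
    AlternativeOverlap Γ x ∨
      ∃ β : Fin n → ℂ, (∀ l, (1, β l) ∈ weylFamily (Γ l) x) ∧ ∑ l, β l = 0 := by
  obtain ⟨u, hu, hu0⟩ := (Submodule.ne_bot_iff _).1 hx
  obtain ⟨α, β, h, hβ⟩ := mem_eigenspace_pasting_iff.1 hu
  rcases eq_or_ne α 0 with rfl | hα
  · left
    obtain ⟨l, hl⟩ : ∃ l, u l ≠ 0 := by
      by_contra! hall
      exact hu0 (PiLp.ext hall)
    have hmult := mem_pointSpectrum_iff_eigenMultiplicity_ne_zero.1 hx
    rw [eigenMultiplicity_pasting_of_mem_pointSpectrum hfun hΓ hker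
      ⟨l, mem_pointSpectrum_kerPi₁_iff.2 ⟨u l, β l, hl, h l⟩⟩, Nat.cast_ne_zero] at hmult
    unfold AlternativeOverlap
    omega
  · right
    refine ⟨fun l => α⁻¹ * β l, fun l => ⟨α⁻¹ • u l, ?_⟩, by rw [← Finset.mul_sum, hβ, mul_zero]⟩
    have := (solutionSpace (Γ l) x).smul_mem α⁻¹ (h l)
    rwa [Prod.smul_mk, Prod.smul_mk, smul_eq_mul, smul_eq_mul, inv_mul_cancel₀ hα] at this

theorem alternativeNew_iff [∀ l, CompleteSpace (H l)] (hfun : ∀ l, IsFunctionType (Γ l)) :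
    AlternativeNew Γ x ↔
      ∃ β : Fin n → ℂ, (∀ l, (1, β l) ∈ weylFamily (Γ l) x) ∧ ∑ l, β l = 0 := by
  have hiff (l : Fin n) := (hΓ l).ofReal_mem_weylFamily_iff (hfun l) (hker l)
  constructor
  · rintro ⟨m, hm, hd, hsum⟩
    exact ⟨fun l => m l, fun l => (hiff l _).2 ⟨hm l, hd l⟩, by
      rw [← ofReal_sum, hsum, ofReal_zero]⟩
  · rintro ⟨β, hmem, hβ⟩
    have hreal (l : Fin n) : ((β l).re : ℂ) = β l := by
      obtain ⟨f, hf⟩ := hmem l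
      exact conj_eq_iff_re.1 ((hΓ l).conj_eq_of_mem_solutionSpace hf)
    have hlim (l : Fin n) := (hiff l (β l).re).1 ((hreal l).symm ▸ hmem l)
    exact ⟨fun l => (β l).re, fun l => (hlim l).1, fun l => (hlim l).2, by
      rw [← re_sum, hβ, zero_re]⟩

end Paste

end Pasting

theorem theorem3_general {n : ℕ} (hn : 2 ≤ n) {H : Fin n → Type*}
    [∀ l, NormedAddCommGroup (H l)] [∀ l, InnerProductSpace ℂ (H l)] [∀ l, CompleteSpace (H l)]
    (Γ : ∀ l, Submodule ℂ ((H l × H l) × (ℂ × ℂ)))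
    (hΓ : ∀ l, Pasting.IsUnitaryRel (Γ l))
    (hfun : ∀ l, Pasting.IsFunctionType (Γ l))
    (hbf : ∃ l, Pasting.IsBoundaryFunction (Γ l))
    (x : ℝ) (hx : ∀ l, (x : ℂ) ∉ Pasting.pointSpectrum (Pasting.kernel (Γ l))) :
    ((x : ℂ) ∈ Pasting.pointSpectrum (Pasting.pasting hn Γ) ↔
      Pasting.AlternativeOverlap Γ x ∨ Pasting.AlternativeNew Γ x) ∧
    (Pasting.AlternativeOverlap Γ x →
      Pasting.eigenMultiplicity (Pasting.pasting hn Γ) x =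
        (({l : Fin n | (x : ℂ) ∈ Pasting.pointSpectrum (Pasting.kerPi₁ (Γ l))}.ncard - 1 : ℕ) :
          Cardinal) ∧
      Pasting.eigenMultiplicity (Pasting.pasting hn Γ) x =
        (({l : Fin n | ∃ c : ℝ, 0 < c ∧
          Tendsto (fun ε : ℝ => ε * (Pasting.weylFunction (Γ l) (x + Complex.I * ε)).im)
            (𝓝[>] 0) (𝓝 c)}.ncard - 1 : ℕ) : Cardinal)) ∧
    (Pasting.AlternativeNew Γ x →
      Pasting.eigenMultiplicity (Pasting.pasting hn Γ) x = 1) := by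
  simp only [← fun l => (hΓ l).mem_pointSpectrum_kerPi₁_iff_tendsto (hfun l) (hx l), and_self,
    Pasting.alternativeNew_iff hΓ hx hfun]
  have hoverlap (h : Pasting.AlternativeOverlap Γ x) :=
    Pasting.eigenMultiplicity_pasting_of_mem_pointSpectrum (hn := hn) hfun hΓ hx
      (Set.nonempty_of_ncard_ne_zero (two_pos.trans_le h).ne')
  have hnew : (∃ β : Fin n → ℂ, (∀ l, (1, β l) ∈ Pasting.weylFamily (Γ l) x) ∧ ∑ l, β l = 0) →
      Pasting.eigenMultiplicity (Pasting.pasting hn Γ) x = 1 := fun ⟨_, hmem, hβ⟩ =>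
    Pasting.eigenMultiplicity_pasting_eq_one hΓ hx hbf hmem hβ
  refine ⟨⟨Pasting.alternativeOverlap_or_of_mem_pointSpectrum_pasting hΓ hx hfun, ?_⟩,
    hoverlap, hnew⟩
  rw [Pasting.mem_pointSpectrum_iff_eigenMultiplicity_ne_zero]
  rintro (h | h)
  · rw [hoverlap h, Nat.cast_ne_zero]
    exact (Nat.sub_pos_of_lt h).ne'
  · rw [hnew h]
    exact one_ne_zero

theorem theorem3 {n : ℕ} (hn : 2 ≤ n) {H : Fin n → Type*}
    [∀ l, NormedAddCommGroup (H l)] [∀ l, InnerProductSpace ℂ (H l)] [∀ l, CompleteSpace (H l)]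
    (S : ∀ l, Submodule ℂ (H l × H l))
    (hS_closed : ∀ l, IsClosed (S l : Set (H l × H l)))
    (hS_symm : ∀ l, Pasting.IsSymmetricRel (S l))
    (Γ : ∀ l, Submodule ℂ ((H l × H l) × (ℂ × ℂ)))
    (hΓ : ∀ l, Pasting.IsBoundaryRelation (S l) (Γ l))
    (hyp1 : ∀ l, Pasting.IsSimpleRel (S l))
    (hyp2 : ∀ l, Pasting.IsFunctionType (Γ l))
    (hyp3 : ∃ l, Pasting.IsBoundaryFunction (Γ l))
    (x : ℝ) :
    ((x : ℂ) ∈ Pasting.pointSpectrum (Pasting.pasting hn Γ) ↔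
      Pasting.AlternativeOverlap Γ x ∨ Pasting.AlternativeNew Γ x) ∧
    (Pasting.AlternativeOverlap Γ x →
      Pasting.eigenMultiplicity (Pasting.pasting hn Γ) x =
        (({l : Fin n | (x : ℂ) ∈ Pasting.pointSpectrum (Pasting.kerPi₁ (Γ l))}.ncard - 1 : ℕ) :
          Cardinal) ∧
      Pasting.eigenMultiplicity (Pasting.pasting hn Γ) x =
        (({l : Fin n | ∃ c : ℝ, 0 < c ∧
          Tendsto (fun ε : ℝ => ε * (Pasting.weylFunction (Γ l) (x + Complex.I * ε)).im)
            (𝓝[>] 0) (𝓝 c)}.ncard - 1 : ℕ) : Cardinal)) ∧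
    (Pasting.AlternativeNew Γ x →
      Pasting.eigenMultiplicity (Pasting.pasting hn Γ) x = 1) := by
  exact theorem3_general hn Γ (fun l => (hΓ l).isUnitaryRel) hyp2 hyp3 x fun l =>
    (hΓ l).kernel_eq (hS_closed l) ▸ (hyp1 l).notMem_pointSpectrum (hS_symm l) x
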